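/- Let $k\ge 2$. A $k$-uniform hypergraph is a finite vertex set with a set of $k$-element subsets of it, the edges. A tight path of length $\ell\ge 1$ consists of $\ell+k-1$ distinct vertices $v_1,\dots,v_{\ell+k-1}$ such that $\{v_i,v_{i+1},\dots,v_{i+k-1}\}$ is an edge for every $1\le i\le \ell$; its endpoints are $v_1$ and $v_{\ell+k-1}$. The distance between two distinct vertices is the length of a shortest tight path with these endpoints ($\infty$ if there is none), and the diameter of a hypergraph is the maximum distance between two of its vertices. The diameter of a set $F$ of edges is the diameter of the hypergraph whose edges are those in $F$ and whose vertices are the vertices lying in some edge of $F$ (the empty set of edges has diameter $0$). For a positive integer $n$, real $\epsilon\ge 0$ and an integer $d\ge 1$, let $P_k(n,\epsilon,d)$ be the smallest $\ell$ such that the edge set $E$ of every $k$-uniform hypergraph on $n$ vertices can be partitioned as $E=E_0\cup E_1\cup\dots\cup E_\ell$ (disjoint, possibly empty parts) with $|E_0|\le \epsilon n^k$ and each of $E_1,\dots,E_\ell$ of diameter at most $d$. **Theorem.** For every integer $k\ge 2$ there are constants $c_k, C_k, C_k'>0$, depending only on $k$, such that $$P_k(n,\epsilon,3)\;\ge\;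 c_k\,\epsilon^{-k}$$ for every integer $n\ge 1$ and every real $\epsilon$ with $C_k' n^{-1/2}\le \epsilon\le C_k$. -/

import Mathlib

/-- `IsTightPath k E ℓ p`: in the `k`-uniform hypergraph with edge set `E`, the sequence
`p 0, p 1, …, p (ℓ + k - 2)` of `ℓ + k - 1` distinct vertices is a tight path of length `ℓ ≥ 1`,
i.e. each of the `ℓ` windows of `k` consecutive vertices is an edge.
(The values of `p` from the index `ℓ + k - 1` on are irrelevant.) -/
def IsTightPath {V : Type*} [DecidableEq V] (k : ℕ) (E : Finset (Finset V)) (ℓ : ℕ) (p : ℕ → V) :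
    Prop :=
  1 ≤ ℓ ∧ Set.InjOn p (Set.Iio (ℓ + k - 1)) ∧
    ∀ i < ℓ, (Finset.range k).image (fun j => p (i + j)) ∈ E

/-- `TightlyJoined k E ℓ a b`: there is a tight path of length `ℓ` with endpoints `a` and `b`. -/
def TightlyJoined {V : Type*} [DecidableEq V] (k : ℕ) (E : Finset (Finset V)) (ℓ : ℕ) (a b : V) : Prop :=
  ∃ p : ℕ → V, IsTightPath k E ℓ p ∧ p 0 = a ∧ p (ℓ + k - 2) = b

/-- The distance of two vertices: the length of a shortest tight path joining them, `⊤` if there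
is none, and `0` from a vertex to itself. -/
noncomputable def hyperDist {V : Type*} [DecidableEq V] (k : ℕ) (E : Finset (Finset V)) (a b : V) :
    ℕ∞ :=
  if a = b then 0 else ⨅ (ℓ : ℕ) (_ : TightlyJoined k E ℓ a b), (ℓ : ℕ∞)

/-- The vertices of the hypergraph formed by a set of edges: those that lie in one of the edges. -/
def coveredVertices {V : Type*} [DecidableEq V] (E : Finset (Finset V)) : Finset V :=
  E.biUnion id

/-- The diameter of the `k`-uniform hypergraph formed by the edge set `E`
(it is `0` if `E` is empty). -/
noncomputable def hyperDiam {V : Type*} [DecidableEq V] (k : ℕ) (E : Finset (Finset V)) : ℕ∞ :=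
  ⨆ a ∈ coveredVertices E, ⨆ b ∈ coveredVertices E, hyperDist k E a b

/-- The edge set `E` of a `k`-uniform hypergraph on `n` vertices is the disjoint union of
`E₀, E₁, …, E_ℓ`, where `|E₀| ≤ ε n ^ k` and each of `E₁, …, E_ℓ` has diameter at most `d`. -/
def HasDiamPartition (k n : ℕ) (ε : ℝ) (d ℓ : ℕ) (E : Finset (Finset (Fin n))) : Prop :=
  ∃ (E₀ : Finset (Finset (Fin n))) (F : Fin ℓ → Finset (Finset (Fin n))),
    E = E₀ ∪ Finset.univ.biUnion F ∧
    (∀ i, Disjoint E₀ (F i)) ∧ (∀ i j, i ≠ j → Disjoint (F i) (F j)) ∧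
    (E₀.card : ℝ) ≤ ε * (n : ℝ) ^ k ∧
    ∀ i, hyperDiam k (F i) ≤ d

/-- `P_k(n, ε, d)`: the smallest `ℓ` such that every `k`-uniform hypergraph on `n` vertices has an
edge partition `E = E₀ ∪ E₁ ∪ … ∪ E_ℓ` with `|E₀| ≤ ε n ^ k` and with `E₁, …, E_ℓ` of diameter at
most `d`. -/
noncomputable def diamPartitionNumber (k n : ℕ) (ε : ℝ) (d : ℕ) : ℕ :=
  sInf {ℓ : ℕ | ∀ E : Finset (Finset (Fin n)), (E : Set (Finset (Fin n))).Sized k →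
    HasDiamPartition k n ε d ℓ E}

theorem hyperDist_le_iff {V : Type*} [DecidableEq V] (k : ℕ) (E : Finset (Finset V)) (a b : V)
    (d : ℕ) : hyperDist k E a b ≤ d ↔ a = b ∨ ∃ ℓ ≤ d, TightlyJoined k E ℓ a b := by
  unfold hyperDist
  split_ifs with h
  · simp [h]
  · constructor
    · intro H
      right
      by_contra! hc
      have : ((d + 1 : ℕ) : ℕ∞) ≤ ⨅ (ℓ : ℕ) (_ : TightlyJoined k E ℓ a b), (ℓ : ℕ∞) := by
        refine le_iInf₂ fun ℓ hℓ => ?_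
        by_contra hlt
        have h2 : ℓ < d + 1 := by exact_mod_cast not_le.mp hlt
        exact hc ℓ (by omega) hℓ
      have h3 : ((d + 1 : ℕ) : ℕ∞) ≤ (d : ℕ∞) := this.trans H
      have h4 : d + 1 ≤ d := by exact_mod_cast h3
      omega
    · rintro (h' | ⟨ℓ, hℓ, hj⟩)
      · exact absurd h' h
      · exact (iInf₂_le ℓ hj).trans (by exact_mod_cast hℓ)

theorem hyperDiam_le_iff {V : Type*} [DecidableEq V] (k : ℕ) (E : Finset (Finset V)) (d : ℕ) :
    hyperDiam k E ≤ d ↔ ∀ a ∈ coveredVertices E, ∀ b ∈ coveredVertices E, a ≠ b →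
      ∃ ℓ ≤ d, TightlyJoined k E ℓ a b := by
  simp only [hyperDiam, iSup_le_iff, hyperDist_le_iff, ne_eq, or_iff_not_imp_left]

/-- A single edge has diameter at most `1`. -/
theorem hyperDiam_singleton_le {V : Type*} [DecidableEq V] (k : ℕ) (e : Finset V)
    (he : e.card = k) : hyperDiam k {e} ≤ (1 : ℕ) := by
  rw [hyperDiam_le_iff]
  intro a ha b hb hab
  simp only [coveredVertices, Finset.singleton_biUnion, id] at ha hb
  have hk : 2 ≤ k := he ▸ Finset.one_lt_card.mpr ⟨a, ha, b, hb, hab⟩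
  let σ : Fin k ≃ e := (e.equivFinOfCardEq he).symm
  let z : Fin k := ⟨0, by omega⟩
  let w : Fin k := ⟨k - 1, by omega⟩
  have hzw : z ≠ w := by simp only [z, w, ne_eq, Fin.mk.injEq]; omega
  let σ₁ : Fin k ≃ e := σ.trans (Equiv.swap (σ z) ⟨a, ha⟩)
  have h1 : σ₁ z = ⟨a, ha⟩ := by simp [σ₁]
  let σ₂ : Fin k ≃ e := σ₁.trans (Equiv.swap (σ₁ w) ⟨b, hb⟩)
  have h2 : σ₂ w = ⟨b, hb⟩ := by simp [σ₂]
  have h3 : σ₂ z = ⟨a, ha⟩ := by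
    have : σ₁ z ≠ σ₁ w := fun h => hzw (σ₁.injective h)
    simp only [σ₂, Equiv.trans_apply, h1]
    rw [Equiv.swap_apply_of_ne_of_ne]
    · rwa [← h1]
    · simpa using hab
  refine ⟨1, le_rfl, fun i => if h : i < k then (σ₂ ⟨i, h⟩ : V) else a, ⟨le_rfl, ?_, ?_⟩, ?_, ?_⟩
  · intro i hi j hj hij
    simp only [Set.mem_Iio] at hi hj
    have hi' : i < k := by omega
    have hj' : j < k := by omega
    simp only [hi', hj', dif_pos] at hij
    have := σ₂.injective (Subtype.ext hij)
    simpa using this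
  · intro i hi
    obtain rfl : i = 0 := by omega
    simp only [Finset.mem_singleton, zero_add]
    ext x
    simp only [Finset.mem_image, Finset.mem_range]
    constructor
    · rintro ⟨j, hj, rfl⟩
      simp [hj]
    · intro hx
      refine ⟨σ₂.symm ⟨x, hx⟩, (σ₂.symm ⟨x, hx⟩).2, ?_⟩
      simp
  · have : 0 < k := by omega
    simp only [this, dif_pos]
    exact congrArg Subtype.val h3
  · have h4 : 1 + k - 2 = k - 1 := by omega
    have : k - 1 < k := by omega
    simp only [h4, this, dif_pos]
    exact congrArg Subtype.val h2

/-- The set whose least element is `P_k(n, ε, d)` is nonempty for `ε ≥ 0` and `d ≥ 1`. -/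
theorem diamPartitionNumber_set_nonempty (k n : ℕ) (ε : ℝ) (hε : 0 ≤ ε) (d : ℕ) (hd : 1 ≤ d) :
    {ℓ : ℕ | ∀ E : Finset (Finset (Fin n)), (E : Set (Finset (Fin n))).Sized k →
      HasDiamPartition k n ε d ℓ E}.Nonempty := by
  obtain ⟨N, ⟨σ⟩⟩ : ∃ N, Nonempty (Fin N ≃ Finset (Fin n)) :=
    ⟨_, ⟨(Fintype.equivFin (Finset (Fin n))).symm⟩⟩
  refine ⟨N, fun E hE => ⟨∅, fun i => E ∩ {σ i}, ?_, by simp, ?_, ?_, ?_⟩⟩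
  · ext e
    simp only [Finset.empty_union, Finset.mem_biUnion, Finset.mem_univ, true_and,
      Finset.mem_inter, Finset.mem_singleton]
    exact ⟨fun h => ⟨σ.symm e, h, by simp⟩, fun ⟨_, h, _⟩ => h⟩
  · intro i j hij
    rw [Finset.disjoint_left]
    intro e he he'
    simp only [Finset.mem_inter, Finset.mem_singleton] at he he'
    exact hij (σ.injective (he.2.symm.trans he'.2))
  · simpa using by positivity
  · intro i
    beta_reduce
    by_cases h : σ i ∈ E
    · rw [Finset.inter_singleton_of_mem h]
      exact (hyperDiam_singleton_le k _ (hE h)).trans (by exact_mod_cast hd)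
    · rw [Finset.inter_singleton_of_notMem h, hyperDiam_le_iff]
      simp [coveredVertices]

/-! It suffices to find a hypergraph with many edges in which every edge set of diameter at most 3
is small. Take `k` parts, each a copy of `ZMod q × ZMod q` with every point blown up into `N`
copies; a transversal is an edge when its second coordinates sum to `Q` of its first coordinates.
This gives `q ^ (2 * k - 1) * N ^ k` edges. In a `k`-partite hypergraph a tight path of length at
most 3 between two vertices of one part has length 2, so its ends extend a common set of `k - 1`
vertices to edges. Hence an edge set of diameter at most 3 is partwise linked, and so is its
projection forgetting the blow-up. For a suitable `Q`, `exists_sparse_partwiseLinked` bounds the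
projection by a constant times `q ^ (k - 1)`. So each part of a partition has at most a constant
times `q ^ (k - 1) * N ^ k` edges, and covering half of all edges takes at least a constant times `q
^ k` parts. Finally `q` is chosen of order `1 / ε`, with `E₀` taking at most half of the edges
counted above. For `k ≥ 3` linkedness makes the second coordinate in each part a function of the
first, and a random `Q` rarely agrees with a sum of one-variable functions. For `k = 2` there are
too many such functions for this union bound. There `Q` is the product, edges are point-line
incidences, and linked families are controlled by the absence of proper subplanes over a prime
field. -/

/-- A family `R` of transversals of `k` parts is partwise linked if any two elements of the `i`-th
part that it covers have a common neighbour, i.e. extend to two members of `R` which agree outside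
the `i`-th part. -/
def PartwiseLinked {k : ℕ} {α : Type*} (R : Finset (Fin k → α)) : Prop :=
  ∀ i, ∀ x ∈ R, ∀ y ∈ R, x i ≠ y i →
    ∃ z ∈ R, ∃ w ∈ R, z i = x i ∧ w i = y i ∧ ∀ j, j ≠ i → z j = w j

/-! ### Point-line incidences over a prime field (the case `k = 2`). -/

/-- A set of points of a projective plane (in homogeneous coordinates) that contains a frame and the
intersection of any two distinct lines spanned by it contains the points `(1 : n : 0)`. -/
theorem natCast_mem_of_closed {K : Type*} [Field K] {I : Set (K × K × K)}
    (hI : ∀ a b c d x, a ∈ I → b ∈ I → c ∈ I → d ∈ I → (∀ r : K, a ≠ r • b) → (∀ r : K, c ≠ r • d) →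
      (∃ r s : K, x = r • a + s • b) → (∃ r s : K, x = r • c + s • d) → x ≠ 0 →
      (∀ f g h : K, f * a.1 + g * a.2.1 + h * a.2.2 = 0 → f * b.1 + g * b.2.1 + h * b.2.2 = 0 →
        f * c.1 + g * c.2.1 + h * c.2.2 = 0 → f * d.1 + g * d.2.1 + h * d.2.2 = 0 →
        f = 0 ∧ g = 0 ∧ h = 0) → x ∈ I)
    (hu : (1, 0, 0) ∈ I) (hv : (0, 1, 0) ∈ I) (hw : (0, 0, 1) ∈ I) (he : (1, 1, 1) ∈ I) (n : ℕ) :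
    (1, (n : K), 0) ∈ I := by
  -- With `u, v, w, e` the given frame, this is `uv ∩ we`; next comes `uw ∩ ve`. The line joining
  -- these two meets `vw` in `(0 : 1 : -1)`.
  have huv : (1, 1, 0) ∈ I := by
    refine hI _ _ _ _ (1, 1, 0) hu hv hw he (by simp) (by simp) ⟨1, 1, by simp⟩
      ⟨-1, 1, by simp⟩ (by simp) ?_
    intro f g h h1 h2 h3 h4
    exact ⟨by linear_combination h1, by linear_combination h2, by linear_combination h3⟩
  have huw : (1, 0, 1) ∈ I := by
    refine hI _ _ _ _ (1, 0, 1) hu hw hv he (by simp) (by simp) ⟨1, 1, by simp⟩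
      ⟨-1, 1, by simp⟩ (by simp) ?_
    intro f g h h1 h2 h3 h4
    exact ⟨by linear_combination h1, by linear_combination h3, by linear_combination h2⟩
  have hvw : (0, 1, -1) ∈ I := by
    refine hI _ _ _ _ (0, 1, -1) hv hw huv huw (by simp) ?_ ⟨1, -1, by simp⟩
      ⟨1, -1, by simp⟩ (by simp) ?_
    · intro r h
      simp only [Prod.smul_mk, smul_eq_mul, Prod.mk.injEq] at h
      simp at h
    · intro f g h h1 h2 h3 h4
      exact ⟨by linear_combination h3 - h1, by linear_combination h1, by linear_combination h2⟩
  induction n with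
  | zero => simpa using hu
  | succ n ih =>
    -- Adding one: `(1 : n : 1)` is where the line from `(1 : n : 0)` to `w` meets the line from `(1
    -- : 0 : 1)` to `v`. Its join with `(0 : 1 : -1)` meets `uv` in `(1 : n + 1 : 0)`.
    have h1 : (1, (n : K), 1) ∈ I := by
      refine hI _ _ _ _ (1, (n : K), 1) ih hw huw hv (by simp) (by simp) ⟨1, 1, by simp⟩
        ⟨1, n, by simp⟩ (by simp) ?_
      intro f g h h1 h2 h3 h4
      exact ⟨by linear_combination h1 - n * h4, by linear_combination h4, by linear_combination h2⟩
    refine hI _ _ _ _ (1, ((n + 1 : ℕ) : K), 0) h1 hvw hu hv (by simp) (by simp) ⟨1, 1, by simp⟩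
      ⟨1, (n + 1 : ℕ), by simp⟩ (by simp) ?_
    intro f g h h1 h2 h3 h4
    exact ⟨by linear_combination h3, by linear_combination h4,
      by linear_combination h1 - h3 - n * h4⟩

/-- The linear form of the line `l`, evaluated at `y` in homogeneous coordinates. -/
def lineForm {K : Type*} [Field K] (l : K × K) (y : K × K × K) : K :=
  y.2.1 + l.2 * y.2.2 - y.1 * l.1

theorem lineForm_add {K : Type*} [Field K] (l : K × K) (x y : K × K × K) :
    lineForm l (x + y) = lineForm l x + lineForm l y := by
  simp only [lineForm, Prod.fst_add, Prod.snd_add]; ring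

theorem lineForm_smul {K : Type*} [Field K] (l : K × K) (r : K) (x : K × K × K) :
    lineForm l (r • x) = r * lineForm l x := by
  simp only [lineForm, Prod.smul_fst, Prod.smul_snd, smul_eq_mul]; ring

/-- The homogeneous coordinates of an affine point. -/
def homogenize {K : Type*} [Field K] (P : K × K) : K × K × K := (P.1, P.2, 1)

theorem lineForm_homogenize {K : Type*} [Field K] (l P : K × K) :
    lineForm l (homogenize P) = 0 ↔ P.2 + l.2 = P.1 * l.1 := by
  simp [lineForm, homogenize, sub_eq_zero]

theorem line_unique {K : Type*} [Field K] {P P' l l' : K × K} (h : P.1 ≠ P'.1)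
    (h1 : P.2 + l.2 = P.1 * l.1) (h2 : P'.2 + l.2 = P'.1 * l.1)
    (h3 : P.2 + l'.2 = P.1 * l'.1) (h4 : P'.2 + l'.2 = P'.1 * l'.1) : l = l' := by
  have h5 : l.1 = l'.1 := by
    have : (P.1 - P'.1) * (l.1 - l'.1) = 0 := by linear_combination -h1 + h2 + h3 - h4
    rcases mul_eq_zero.mp this with h' | h'
    · exact absurd (sub_eq_zero.mp h') h
    · exact sub_eq_zero.mp h'
  refine Prod.ext h5 ?_
  rw [h5] at h1
  linear_combination h1 - h3

theorem homogenize_combination {K : Type*} [Field K] {A B Z l : K × K} (h : A.1 ≠ B.1)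
    (hA : A.2 + l.2 = A.1 * l.1) (hB : B.2 + l.2 = B.1 * l.1) (hZ : Z.2 + l.2 = Z.1 * l.1)
    (hZA : Z.1 ≠ A.1) (hZB : Z.1 ≠ B.1) :
    ∃ r s : K, r ≠ 0 ∧ s ≠ 0 ∧ r + s = 1 ∧
      homogenize Z = r • homogenize A + s • homogenize B := by
  have h0 : A.1 - B.1 ≠ 0 := sub_ne_zero.mpr h
  refine ⟨(Z.1 - B.1) / (A.1 - B.1), (A.1 - Z.1) / (A.1 - B.1),
    div_ne_zero (sub_ne_zero.mpr hZB) h0, div_ne_zero (sub_ne_zero.mpr hZA.symm) h0, ?_, ?_⟩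
  · field_simp; ring
  · simp only [homogenize, Prod.smul_mk, smul_eq_mul, Prod.mk_add_mk, Prod.mk.injEq]
    refine ⟨?_, ?_, ?_⟩
    · field_simp; ring
    · rw [eq_sub_of_add_eq hA, eq_sub_of_add_eq hB, eq_sub_of_add_eq hZ]
      field_simp; ring
    · field_simp; ring

/-- Let `R` be a set of incidences between affine points and non-vertical lines over a prime field,
such that any two points have a common line and any two lines have a common point. Then there are
no two lines with three points each. -/
theorem no_two_long_lines {p : ℕ} [Fact p.Prime] (R : ZMod p × ZMod p → ZMod p × ZMod p → Prop)
    (inc : ∀ P l, R P l → P.2 + l.2 = P.1 * l.1)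
    (hP : ∀ P P', (∃ l, R P l) → (∃ l, R P' l) → P ≠ P' → ∃ l, R P l ∧ R P' l)
    (hL : ∀ l l', (∃ P, R P l) → (∃ P, R P l') → l ≠ l' → ∃ P, R P l ∧ R P l')
    {l₀ l₁ Z A B X Y : ZMod p × ZMod p} (hl : l₀ ≠ l₁) (hZ0 : R Z l₀) (hZ1 : R Z l₁)
    (hA : R A l₀) (hB : R B l₀) (hX : R X l₁) (hY : R Y l₁)
    (hZA : Z ≠ A) (hZB : Z ≠ B) (hAB : A ≠ B) (hZX : Z ≠ X) (hZY : Z ≠ Y) (hXY : X ≠ Y) :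
    False := by
  have hne : ∀ {P P'}, (∃ l, R P l) → (∃ l, R P' l) → P ≠ P' → P.1 ≠ P'.1 := by
    intro P P' h1 h2 hPP' h
    obtain ⟨l, h3, h4⟩ := hP P P' h1 h2 hPP'
    have h5 := inc _ _ h3
    have h6 := inc _ _ h4
    rw [← h] at h6
    exact hPP' (Prod.ext h (by linear_combination h5 - h6))
  obtain ⟨α, β, hα, hβ, -, hz0⟩ := homogenize_combination (hne ⟨_, hA⟩ ⟨_, hB⟩ hAB)
    (inc _ _ hA) (inc _ _ hB) (inc _ _ hZ0) (hne ⟨_, hZ0⟩ ⟨_, hA⟩ hZA) (hne ⟨_, hZ0⟩ ⟨_, hB⟩ hZB)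
  obtain ⟨ξ, η, hξ, hη, -, hz1⟩ := homogenize_combination (hne ⟨_, hX⟩ ⟨_, hY⟩ hXY)
    (inc _ _ hX) (inc _ _ hY) (inc _ _ hZ1) (hne ⟨_, hZ0⟩ ⟨_, hX⟩ hZX) (hne ⟨_, hZ0⟩ ⟨_, hY⟩ hZY)
  -- Coordinates in which `A, B, X, Y` form the standard frame: `(1, 1, 0)` goes to `Z`, so `(1, 1,
  -- 1)` goes to `Z - ξ X = η Y`.
  let T : ZMod p × ZMod p × ZMod p → ZMod p × ZMod p × ZMod p := fun c =>
    (c.1 * α) • homogenize A + (c.2.1 * β) • homogenize B + (c.2.2 * -ξ) • homogenize X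
  have T_add : ∀ x y, T (x + y) = T x + T y := by
    intro x y
    simp only [T, Prod.fst_add, Prod.snd_add, add_mul, add_smul]
    abel
  have T_smul : ∀ (r : ZMod p) x, T (r • x) = r • T x := by
    intro r x
    simp only [T, Prod.smul_fst, Prod.smul_snd, smul_eq_mul, mul_assoc, smul_add, smul_smul]
  have hXl : lineForm l₀ (homogenize X) ≠ 0 := by
    rw [Ne, lineForm_homogenize]
    intro h
    exact hl (line_unique (hne ⟨_, hZ0⟩ ⟨_, hX⟩ hZX) (inc _ _ hZ0) h (inc _ _ hZ1) (inc _ _ hX))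
  have T_zero : ∀ c, T c = 0 → c = 0 := by
    intro c hc
    have h1 : lineForm l₀ (T c) = 0 := by rw [hc]; simp [lineForm]
    simp only [T, lineForm_add, lineForm_smul, (lineForm_homogenize _ _).mpr (inc _ _ hA),
      (lineForm_homogenize _ _).mpr (inc _ _ hB)] at h1
    have h2 : c.2.2 = 0 := by simpa [hξ, hXl] using h1
    have h3 := congrArg Prod.fst hc
    have h4 := congrArg (fun c => c.2.2) hc
    simp [T, homogenize, h2] at h3 h4
    have h5 : c.1 * α * (A.1 - B.1) = 0 := by linear_combination h3 - B.1 * h4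
    have h6 : c.1 = 0 := by
      simpa [hα, sub_ne_zero.mpr (hne ⟨_, hA⟩ ⟨_, hB⟩ hAB)] using h5
    have h7 : c.2.1 = 0 := by simpa [h6, hβ] using h4
    exact Prod.ext h6 (Prod.ext h7 h2)
  let I : Set (ZMod p × ZMod p × ZMod p) :=
    {c | ∃ P, (∃ l, R P l) ∧ ∃ r : ZMod p, r ≠ 0 ∧ T c = r • homogenize P}
  have common : ∀ a b, a ∈ I → b ∈ I → (∀ r : ZMod p, a ≠ r • b) →
      ∃ l, (∃ P, R P l) ∧ lineForm l (T a) = 0 ∧ lineForm l (T b) = 0 := by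
    rintro a b ⟨P, hPl, r, hr, hPa⟩ ⟨P', hPl', r', hr', hPb⟩ hab
    have hPP' : P ≠ P' := by
      rintro rfl
      refine hab (r / r') (sub_eq_zero.mp (T_zero _ ?_))
      have : a - (r / r') • b = a + (-(r / r')) • b := by rw [neg_smul, sub_eq_add_neg]
      have h0 : r + -(r / r') * r' = 0 := by rw [neg_mul, div_mul_cancel₀ _ hr', add_neg_cancel]
      rw [this, T_add, T_smul, hPa, hPb, smul_smul, ← add_smul, h0, zero_smul]
    obtain ⟨l, h1, h2⟩ := hP P P' hPl hPl' hPP'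
    refine ⟨l, ⟨P, h1⟩, ?_, ?_⟩
    · rw [hPa, lineForm_smul, (lineForm_homogenize _ _).mpr (inc _ _ h1), mul_zero]
    · rw [hPb, lineForm_smul, (lineForm_homogenize _ _).mpr (inc _ _ h2), mul_zero]
  have closed : ∀ n : ℕ, (1, (n : ZMod p), 0) ∈ I := by
    intro n
    refine natCast_mem_of_closed (I := I) ?_ ⟨A, ⟨_, hA⟩, α, hα, by simp [T]⟩
      ⟨B, ⟨_, hB⟩, β, hβ, by simp [T]⟩
      ⟨X, ⟨_, hX⟩, -ξ, neg_ne_zero.mpr hξ, by simp [T]⟩ ⟨Y, ⟨_, hY⟩, η, hη, ?_⟩ n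
    · rintro a b c d x ha hb hc hd hab hcd ⟨r, s, h1⟩ ⟨r', s', h2⟩ hx hind
      obtain ⟨l, hPl, hla, hlb⟩ := common a b ha hb hab
      obtain ⟨l', hPl', hlc, hld⟩ := common c d hc hd hcd
      -- Were the lines equal, one form would vanish at all four points, hence at `A`, `B` and `X`;
      -- but `X` is off `l₀`.
      have hll' : l ≠ l' := by
        rintro rfl
        have key : ∀ y, lineForm l (T y) = α * lineForm l (homogenize A) * y.1 +
            β * lineForm l (homogenize B) * y.2.1 + -ξ * lineForm l (homogenize X) * y.2.2 := by
          intro y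
          simp only [T, lineForm_add, lineForm_smul]
          ring
        rw [key] at hla hlb hlc hld
        obtain ⟨h3, h4, h5⟩ := hind _ _ _ hla hlb hlc hld
        have h6 : lineForm l (homogenize A) = 0 := by simpa [hα] using h3
        have h7 : lineForm l (homogenize B) = 0 := by simpa [hβ] using h4
        have h8 : lineForm l (homogenize X) = 0 := by simpa [hξ] using h5
        rw [lineForm_homogenize] at h6 h7
        have := line_unique (hne ⟨_, hA⟩ ⟨_, hB⟩ hAB) h6 h7 (inc _ _ hA) (inc _ _ hB)
        exact hXl (this ▸ h8)
      obtain ⟨P, h3, h4⟩ := hL l l' hPl hPl' hll'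
      have h5 : lineForm l (T x) = 0 := by
        rw [h1, T_add, T_smul, T_smul, lineForm_add, lineForm_smul, lineForm_smul, hla, hlb]; simp
      have h6 : lineForm l' (T x) = 0 := by
        rw [h2, T_add, T_smul, T_smul, lineForm_add, lineForm_smul, lineForm_smul, hlc, hld]; simp
      have h3 := inc _ _ h3
      have h4' := inc _ _ h4
      -- Two distinct lines with a common affine point have different slopes, so `T x` can only be a
      -- multiple of that point.
      have hne1 : l.1 - l'.1 ≠ 0 := by
        intro h
        have h := sub_eq_zero.mp h
        rw [← h] at h4'
        exact hll' (Prod.ext h (by linear_combination h3 - h4'))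
      simp only [lineForm] at h5 h6
      have h7 : (T x).1 = (T x).2.2 * P.1 := by
        have : (l.1 - l'.1) * ((T x).1 - (T x).2.2 * P.1) = 0 := by
          linear_combination h6 - h5 + (T x).2.2 * (h3 - h4')
        exact sub_eq_zero.mp ((mul_eq_zero.mp this).resolve_left hne1)
      have h8 : (T x).2.1 = (T x).2.2 * P.2 := by
        rw [h7] at h5
        linear_combination h5 - (T x).2.2 * h3
      have h9 : T x = (T x).2.2 • homogenize P := by
        refine Prod.ext ?_ (Prod.ext ?_ ?_)
        · simpa [homogenize] using h7
        · simpa [homogenize] using h8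
        · simp [homogenize]
      refine ⟨P, ⟨_, h4⟩, (T x).2.2, ?_, h9⟩
      intro h
      rw [h, zero_smul] at h9
      exact hx (T_zero _ h9)
    · simp only [T, one_mul]
      rw [← hz0, hz1]
      simp
  -- Over a prime field the natural numbers reach `-α / β`, which gives the point at infinity of
  -- `l₀`; but every point of `I` corresponds to an affine point.
  obtain ⟨P, -, r, hr, h⟩ := closed (-α / β).val
  have h1 := congrArg (fun c => c.2.2) h
  simp only [T, homogenize, ZMod.natCast_val, ZMod.cast_id', id_eq, Prod.snd_add,
    Prod.smul_snd, smul_eq_mul] at h1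
  apply hr
  have : -α / β * β = -α := div_mul_cancel₀ _ hβ
  linear_combination -h1 + this

/-- Any two lines meet, so slopes are distinct and there are at most `p` lines. By
`no_two_long_lines` all but one of them carry at most 2 points, and the exceptional one carries at
most `p`: in total `2 * p + p`. -/
theorem card_le_of_partwiseLinked_pairs {p : ℕ} [Fact p.Prime]
    (R : Finset (Fin 2 → ZMod p × ZMod p)) (hR : PartwiseLinked R)
    (inc : ∀ x ∈ R, (x 0).2 + (x 1).2 = (x 0).1 * (x 1).1) : R.card ≤ 3 * p := by
  classical
  have hx : ∀ x : Fin 2 → ZMod p × ZMod p, x = ![x 0, x 1] := by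
    intro x; ext i : 1; fin_cases i <;> rfl
  have incR : ∀ P l, ![P, l] ∈ R → P.2 + l.2 = P.1 * l.1 := fun P l h => inc _ h
  have hP : ∀ P P', (∃ l, ![P, l] ∈ R) → (∃ l, ![P', l] ∈ R) → P ≠ P' →
      ∃ l, ![P, l] ∈ R ∧ ![P', l] ∈ R := by
    rintro P P' ⟨l, h⟩ ⟨l', h'⟩ hne
    obtain ⟨z, hz, w, hw, h1, h2, h3⟩ := hR 0 _ h _ h' hne
    rw [hx z] at hz
    rw [hx w] at hw
    have h3 := h3 1 (by decide)
    simp only [Matrix.cons_val_zero] at h1 h2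
    rw [h1] at hz
    rw [h2, ← h3] at hw
    exact ⟨_, hz, hw⟩
  have hL : ∀ l l', (∃ P, ![P, l] ∈ R) → (∃ P, ![P, l'] ∈ R) → l ≠ l' →
      ∃ P, ![P, l] ∈ R ∧ ![P, l'] ∈ R := by
    rintro l l' ⟨P, h⟩ ⟨P', h'⟩ hne
    obtain ⟨z, hz, w, hw, h1, h2, h3⟩ := hR 1 _ h _ h' hne
    rw [hx z] at hz
    rw [hx w] at hw
    have h3 := h3 0 (by decide)
    simp only [Matrix.cons_val_one, Matrix.cons_val_zero] at h1 h2
    rw [h1] at hz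
    rw [h2, ← h3] at hw
    exact ⟨_, hz, hw⟩
  let pts : ZMod p × ZMod p → Finset (ZMod p × ZMod p) := fun l =>
    Finset.univ.filter (fun P => ![P, l] ∈ R)
  have mem_pts : ∀ {P l}, P ∈ pts l ↔ ![P, l] ∈ R := by simp [pts]
  let L := R.image (fun x => x 1)
  have mem_L : ∀ l ∈ L, ∃ P, ![P, l] ∈ R := by
    intro l hl
    obtain ⟨x, hxR, rfl⟩ := Finset.mem_image.mp hl
    exact ⟨x 0, hx x ▸ hxR⟩
  have cardR : R.card ≤ ∑ l ∈ L, (pts l).card := by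
    rw [Finset.card_eq_sum_card_image (fun x => x 1) R]
    refine Finset.sum_le_sum fun l _ => ?_
    refine Finset.card_le_card_of_injOn (fun x => x 0) ?_ ?_
    · intro x hxm
      obtain ⟨h1, h2⟩ := Finset.mem_filter.mp hxm
      rw [hx x, h2] at h1
      exact mem_pts.mpr h1
    · intro x hxm y hym hxy
      have h1 := (Finset.mem_filter.mp hxm).2
      have h2 := (Finset.mem_filter.mp hym).2
      rw [hx x, hx y, h1, h2]
      exact congrArg (fun a => ![a, l]) hxy
  have cardL : L.card ≤ p := by
    have : L.card ≤ (Finset.univ : Finset (ZMod p)).card := by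
      refine Finset.card_le_card_of_injOn Prod.fst (fun _ _ => Finset.mem_univ _) ?_
      intro l hl l' hl' h
      by_contra hne
      obtain ⟨P, h1, h2⟩ := hL l l' (mem_L l hl) (mem_L l' hl') hne
      have h1 := incR _ _ h1
      have h2 := incR _ _ h2
      rw [← h] at h2
      exact hne (Prod.ext h (by linear_combination h1 - h2))
    simpa [ZMod.card] using this
  have card_pts : ∀ l, (pts l).card ≤ p := by
    intro l
    have : (pts l).card ≤ (Finset.univ : Finset (ZMod p)).card := by
      refine Finset.card_le_card_of_injOn Prod.fst (fun _ _ => Finset.mem_univ _) ?_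
      intro P h1 P' h2 h
      have h1 := incR _ _ (mem_pts.mp h1)
      have h2 := incR _ _ (mem_pts.mp h2)
      rw [← h] at h2
      exact Prod.ext h (by linear_combination h1 - h2)
    simpa [ZMod.card] using this
  have two_lines : ∀ l₀ ∈ L, ∀ l₁ ∈ L, l₀ ≠ l₁ → 3 ≤ (pts l₀).card → (pts l₁).card ≤ 2 := by
    intro l₀ h₀ l₁ h₁ hne hc0
    by_contra! hc1
    obtain ⟨Z, hZ0, hZ1⟩ := hL l₀ l₁ (mem_L _ h₀) (mem_L _ h₁) hne
    have key : ∀ l, ![Z, l] ∈ R → 2 < (pts l).card →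
        ∃ A B, ![A, l] ∈ R ∧ ![B, l] ∈ R ∧ Z ≠ A ∧ Z ≠ B ∧ A ≠ B := by
      intro l hZl hcard
      have : 1 < ((pts l).erase Z).card := by
        rw [Finset.card_erase_of_mem (mem_pts.mpr hZl)]
        omega
      obtain ⟨A, hA, B, hB, hAB⟩ := Finset.one_lt_card.mp this
      obtain ⟨hA1, hA2⟩ := Finset.mem_erase.mp hA
      obtain ⟨hB1, hB2⟩ := Finset.mem_erase.mp hB
      exact ⟨A, B, mem_pts.mp hA2, mem_pts.mp hB2, hA1.symm, hB1.symm, hAB⟩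
    obtain ⟨A, B, hA, hB, hZA, hZB, hAB⟩ := key l₀ hZ0 hc0
    obtain ⟨X, Y, hX, hY, hZX, hZY, hXY⟩ := key l₁ hZ1 hc1
    exact no_two_long_lines (fun P l => ![P, l] ∈ R) incR hP hL hne hZ0 hZ1 hA hB hX hY
      hZA hZB hAB hZX hZY hXY
  by_cases h : ∃ l₀ ∈ L, 3 ≤ (pts l₀).card
  · obtain ⟨l₀, hl₀, hc⟩ := h
    have h1 : ∑ l ∈ L.erase l₀, (pts l).card ≤ (L.erase l₀).card • 2 :=
      Finset.sum_le_card_nsmul _ _ _ fun l hl =>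
        two_lines l₀ hl₀ l (Finset.mem_of_mem_erase hl) (Finset.ne_of_mem_erase hl).symm hc
    have h2 := Finset.add_sum_erase L (fun l => (pts l).card) hl₀
    have h3 := Finset.card_erase_le (s := L) (a := l₀)
    have h4 := card_pts l₀
    simp only [smul_eq_mul] at h1 h2
    omega
  · push Not at h
    have h1 : ∑ l ∈ L, (pts l).card ≤ L.card • 2 :=
      Finset.sum_le_card_nsmul _ _ _ fun l hl => Nat.le_of_lt_succ (h l hl)
    simp only [smul_eq_mul] at h1
    omega

/-! ### Random functions, and the choice of `Q`. -/

theorem succ_pow_self_le (q : ℕ) : (q + 1) ^ q ≤ 4 * q ^ q := by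
  rcases Nat.eq_zero_or_pos q with rfl | hq
  · simp
  have hq' : (0 : ℝ) < q := by exact_mod_cast hq
  have h1 : ((q : ℝ)⁻¹ + 1) ^ q ≤ Real.exp 1 := by
    calc ((q : ℝ)⁻¹ + 1) ^ q ≤ Real.exp ((q : ℝ)⁻¹) ^ q := by
          gcongr; exact Real.add_one_le_exp _
      _ = Real.exp 1 := by
          rw [← Real.exp_nat_mul, mul_inv_cancel₀ hq'.ne']
  have h2 : ((q : ℝ) + 1) ^ q = ((q : ℝ)⁻¹ + 1) ^ q * (q : ℝ) ^ q := by
    rw [← mul_pow]; congr 1; field_simp; ring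
  have h3 := Real.exp_one_lt_d9
  have h4 : ((q : ℝ) + 1) ^ q ≤ 4 * (q : ℝ) ^ q := by
    rw [h2]
    gcongr
    linarith
  exact_mod_cast h4

/-- The moment identity behind the first moment method for random functions. -/
theorem sum_two_pow_card_agree {S T : Type*} [Fintype S] [Fintype T] [DecidableEq S] [DecidableEq T]
    (g : S → T) :
    ∑ Q : S → T, 2 ^ (Finset.univ.filter (fun s => g s = Q s)).card =
      (Fintype.card T + 1) ^ Fintype.card S := by
  have h1 : ∀ s : S, ∑ t : T, (if g s = t then 2 else 1) = Fintype.card T + 1 := by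
    intro s
    have : ∀ t : T, (if g s = t then 2 else 1) = 1 + if g s = t then 1 else 0 := by
      intro t; split_ifs <;> rfl
    simp only [this, Finset.sum_add_distrib]
    simp
  calc ∑ Q : S → T, 2 ^ (Finset.univ.filter (fun s => g s = Q s)).card
      = ∑ Q : S → T, ∏ s, (if g s = Q s then 2 else 1) := by
        refine Finset.sum_congr rfl fun Q _ => ?_
        rw [Finset.prod_ite]
        simp
    _ = ∏ s : S, ∑ t : T, (if g s = t then 2 else 1) := by
        rw [Finset.prod_univ_sum, Fintype.piFinset_univ]
    _ = _ := by simp [h1]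

/-- A random function of `k ≥ 3` variables agrees with no sum of functions of one variable much more
often than expected. -/
theorem exists_function_with_few_agreements (k q : ℕ) (hk : 3 ≤ k) [NeZero q] :
    ∃ Q : (Fin k → ZMod q) → ZMod q, ∀ f : Fin k → ZMod q → ZMod q,
      (Finset.univ.filter (fun s => ∑ i, f i (s i) = Q s)).card ≤ (k + 2) * q ^ (k - 1) := by
  classical
  by_contra! H
  have hq : 0 < q := Nat.pos_of_ne_zero (NeZero.ne q)
  set T := (k + 2) * q ^ (k - 1) with hT
  let F := Fin k → ZMod q → ZMod q
  let G := (Fin k → ZMod q) → ZMod q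
  have cardS : Fintype.card (Fin k → ZMod q) = q ^ k := by simp [ZMod.card]
  have cardG : Fintype.card G = q ^ q ^ k := by simp [G, ZMod.card]
  have cardF : Fintype.card F = q ^ (q * k) := by simp [F, ZMod.card, pow_mul]
  -- First moment of `2 ^ agreements`: if every `Q` had a bad `f`, the double sum would be at least
  -- this. Summing over `Q` first shows that it is at most half as large.
  have lower : q ^ q ^ k * 2 ^ (T + 1) ≤
      ∑ Q : G, ∑ f : F, 2 ^ (Finset.univ.filter (fun s => ∑ i, f i (s i) = Q s)).card := by
    have : ∀ Q : G, 2 ^ (T + 1) ≤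
        ∑ f : F, 2 ^ (Finset.univ.filter (fun s => ∑ i, f i (s i) = Q s)).card := by
      intro Q
      obtain ⟨f, hf⟩ := H Q
      exact (Nat.pow_le_pow_right (by norm_num) hf).trans
        (Finset.single_le_sum (f := fun f : F =>
          2 ^ (Finset.univ.filter (fun s => ∑ i, f i (s i) = Q s)).card)
          (fun _ _ => Nat.zero_le _) (Finset.mem_univ f))
    calc q ^ q ^ k * 2 ^ (T + 1) = ∑ Q : G, 2 ^ (T + 1) := by
          rw [Finset.sum_const, Finset.card_univ, cardG, smul_eq_mul]
      _ ≤ _ := Finset.sum_le_sum fun Q _ => this Q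
  have upper : ∑ Q : G, ∑ f : F, 2 ^ (Finset.univ.filter (fun s => ∑ i, f i (s i) = Q s)).card =
      q ^ (q * k) * (q + 1) ^ q ^ k := by
    rw [Finset.sum_comm]
    have : ∀ f : F, ∑ Q : G, 2 ^ (Finset.univ.filter (fun s => ∑ i, f i (s i) = Q s)).card =
        (q + 1) ^ q ^ k := by
      intro f
      rw [sum_two_pow_card_agree (fun s : Fin k → ZMod q => ∑ i, f i (s i)), cardS, ZMod.card]
    rw [Finset.sum_congr rfl fun f _ => this f, Finset.sum_const, Finset.card_univ, cardF,
      smul_eq_mul]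
  have hkq : q ^ k = q * q ^ (k - 1) := by
    rw [← pow_succ']; congr 1; omega
  have h1 : (q + 1) ^ q ^ k ≤ 2 ^ (2 * q ^ (k - 1)) * q ^ q ^ k := by
    calc (q + 1) ^ q ^ k = ((q + 1) ^ q) ^ q ^ (k - 1) := by rw [hkq, pow_mul]
      _ ≤ (4 * q ^ q) ^ q ^ (k - 1) := Nat.pow_le_pow_left (succ_pow_self_le q) _
      _ = 2 ^ (2 * q ^ (k - 1)) * q ^ q ^ k := by
        rw [show 4 = 2 ^ 2 from rfl, mul_pow, hkq, pow_mul 2, pow_mul q]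
  -- The number of tuples `f`. The bound uses `q ^ 2 ≤ q ^ (k - 1)`, which needs `k ≥ 3`.
  have h2 : q ^ (q * k) ≤ 2 ^ (k * q ^ (k - 1)) := by
    calc q ^ (q * k) ≤ (2 ^ q) ^ (q * k) := Nat.pow_le_pow_left Nat.lt_two_pow_self.le _
      _ = 2 ^ (k * q ^ 2) := by rw [← pow_mul]; ring_nf
      _ ≤ 2 ^ (k * q ^ (k - 1)) := by
        refine Nat.pow_le_pow_right (by norm_num) (Nat.mul_le_mul_left _ ?_)
        exact Nat.pow_le_pow_right hq (by omega)
  have h3 : q ^ (q * k) * (q + 1) ^ q ^ k ≤ q ^ q ^ k * 2 ^ T := by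
    calc _ ≤ 2 ^ (k * q ^ (k - 1)) * (2 ^ (2 * q ^ (k - 1)) * q ^ q ^ k) := Nat.mul_le_mul h2 h1
      _ = _ := by rw [hT, add_mul, pow_add]; ring
  have h4 : 0 < q ^ q ^ k * 2 ^ T := by positivity
  rw [upper] at lower
  have h5 : q ^ q ^ k * 2 ^ (T + 1) = 2 * (q ^ q ^ k * 2 ^ T) := by rw [pow_succ]; ring
  omega

theorem exists_sparse_partwiseLinked (k : ℕ) (hk : 2 ≤ k) :
    ∃ C : ℕ, 0 < C ∧ ∀ q : ℕ, q.Prime → ∃ Q : (Fin k → ZMod q) → ZMod q,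
      ∀ R : Finset (Fin k → ZMod q × ZMod q), PartwiseLinked R →
        (∀ x ∈ R, ∑ i, (x i).2 = Q (fun i => (x i).1)) → R.card ≤ C * q ^ (k - 1) := by
  classical
  rcases hk.eq_or_lt with rfl | hk
  · refine ⟨3, by norm_num, fun q hq => ⟨fun s => s 0 * s 1, fun R hR h => ?_⟩⟩
    have := Fact.mk hq
    simpa using card_le_of_partwiseLinked_pairs R hR (fun x hx => by simpa using h x hx)
  · refine ⟨k + 2, by omega, fun q hq => ?_⟩
    have : NeZero q := ⟨hq.ne_zero⟩
    obtain ⟨Q, hQ⟩ := exists_function_with_few_agreements k q hk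
    refine ⟨Q, fun R hR h => ?_⟩
    -- The two linked transversals have the same first coordinates, so the same value of `Q`; as
    -- they differ only in part `i`, their second coordinates there agree too.
    have hfun : ∀ i, ∀ x ∈ R, ∀ y ∈ R, (x i).1 = (y i).1 → x i = y i := by
      intro i x hx y hy hxy
      by_contra hne
      obtain ⟨z, hz, w, hw, hzx, hwy, hzw⟩ := hR i x hx y hy hne
      have h1 : (fun i => (z i).1) = fun i => (w i).1 := by
        funext j
        by_cases hj : j = i
        · subst hj; rw [hzx, hwy, hxy]
        · rw [hzw j hj]
      have h2 : ∑ j, (z j).2 = ∑ j, (w j).2 := by rw [h z hz, h w hw, h1]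
      rw [← Finset.add_sum_erase _ _ (Finset.mem_univ i),
        ← Finset.add_sum_erase _ (fun j => (w j).2) (Finset.mem_univ i)] at h2
      rw [Finset.sum_congr rfl fun j hj => by rw [hzw j (Finset.ne_of_mem_erase hj)]] at h2
      have h3 := add_right_cancel h2
      rw [hzx, hwy] at h3
      exact hne (Prod.ext hxy h3)
    let f : Fin k → ZMod q → ZMod q := fun i s =>
      if hs : ∃ x ∈ R, (x i).1 = s then (hs.choose i).2 else 0
    have hf : ∀ x ∈ R, ∀ i, f i (x i).1 = (x i).2 := by
      intro x hx i
      have hs : ∃ y ∈ R, (y i).1 = (x i).1 := ⟨x, hx, rfl⟩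
      simp only [f, dif_pos hs]
      rw [hfun i _ hs.choose_spec.1 x hx hs.choose_spec.2]
    refine le_trans ?_ (hQ f)
    refine Finset.card_le_card_of_injOn (fun x i => (x i).1) ?_ ?_
    · intro x hx
      simp only [Finset.coe_filter, Finset.mem_univ, true_and, Set.mem_ofPred_eq]
      rw [← h x hx]
      exact Finset.sum_congr rfl fun i _ => hf x hx i
    · intro x hx y hy hxy
      funext i
      exact hfun i x hx y hy (congrFun hxy i)

/-! ### From diameter at most 3 to partwise linked families. -/

/-- In a `k`-partite hypergraph, two vertices of the same part at distance at most `3` have a common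
neighbour, i.e. a set of `k - 1` vertices that forms an edge with each of them. -/
theorem exists_common_link {V : Type*} [DecidableEq V] {k : ℕ} (hk : 2 ≤ k)
    (c : V → Fin k) (E : Finset (Finset V)) (hE : ∀ e ∈ E, Set.InjOn c e) {ℓ : ℕ} (hℓ : ℓ ≤ 3)
    {a b : V} (hab : a ≠ b) (hc : c a = c b) (h : TightlyJoined k E ℓ a b) :
    ∃ S : Finset V, insert a S ∈ E ∧ insert b S ∈ E := by
  obtain ⟨p, ⟨h1, hinj, hwin⟩, rfl, rfl⟩ := h
  have same : ∀ i < ℓ, ∀ u v, u < k → v < k → c (p (i + u)) = c (p (i + v)) → u = v := by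
    intro i hi u v hu hv huv
    have := hE _ (hwin i hi) (Finset.mem_image_of_mem _ (Finset.mem_range.mpr hu))
      (Finset.mem_image_of_mem _ (Finset.mem_range.mpr hv)) huv
    have := hinj (Set.mem_Iio.mpr (by omega)) (Set.mem_Iio.mpr (by omega)) this
    omega
  obtain rfl | rfl | rfl : ℓ = 1 ∨ ℓ = 2 ∨ ℓ = 3 := by omega
  · have := same 0 (by omega) 0 (k - 1) (by omega) (by omega)
      (by simpa [show 1 + k - 2 = k - 1 by omega] using hc)
    omega
  -- For length 2 the common link consists of all the inner vertices of the path.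
  · refine ⟨(Finset.range (k - 1)).image (fun j => p (1 + j)), ?_, ?_⟩
    · convert hwin 0 (by omega) using 1
      ext v
      simp only [Finset.mem_insert, Finset.mem_image, Finset.mem_range]
      constructor
      · rintro (rfl | ⟨j, hj, rfl⟩)
        · exact ⟨0, by omega, rfl⟩
        · exact ⟨1 + j, by omega, by rw [zero_add]⟩
      · rintro ⟨j, hj, rfl⟩
        rcases Nat.eq_zero_or_pos j with rfl | hj0
        · exact Or.inl rfl
        · exact Or.inr ⟨j - 1, by omega, congrArg p (by omega)⟩
    · convert hwin 1 (by omega) using 1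
      ext v
      simp only [Finset.mem_insert, Finset.mem_image, Finset.mem_range]
      constructor
      · rintro (rfl | ⟨j, hj, rfl⟩)
        · exact ⟨k - 1, by omega, congrArg p (by omega)⟩
        · exact ⟨j, by omega, rfl⟩
      · rintro ⟨j, hj, rfl⟩
        rcases (Nat.le_sub_one_of_lt hj).eq_or_lt with rfl | hj0
        · exact Or.inl (congrArg p (by omega))
        · exact Or.inr ⟨j, hj0, rfl⟩
  · exfalso
    -- For length 3 the middle window meets every part, so it has a vertex in the part of the
    -- endpoints. That vertex shares the first window with `a` or the last window with `b`, which is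
    -- impossible.
    have hsurj : Function.Surjective (fun j : Fin k => c (p (1 + j))) := by
      refine Finite.surjective_of_injective fun u v huv => ?_
      exact Fin.ext (same 1 (by omega) u v u.2 v.2 huv)
    obtain ⟨j, hj⟩ := hsurj (c (p (3 + k - 2)))
    simp only at hj
    have hj' := j.2
    rcases Nat.eq_zero_or_pos (j : ℕ) with h0 | h0
    · rw [h0, ← hc] at hj
      have := same 0 (by omega) 1 0 (by omega) (by omega) (by simpa using hj)
      omega
    · have := same 2 (by omega) (j - 1) (k - 1) (by omega) (by omega) (by
        rw [show 2 + ((j : ℕ) - 1) = 1 + j by omega, show 2 + (k - 1) = 3 + k - 2 by omega]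
        exact hj)
      omega

/-- The edge of the complete `k`-partite hypergraph that contains the vertex `z i` of the `i`-th part
for all `i`. -/
def transversalEdge {V γ : Type*} [DecidableEq V] {k : ℕ} (φ : Fin k × γ ↪ V) (z : Fin k → γ) :
    Finset V :=
  Finset.univ.image (fun i => φ (i, z i))

theorem mem_transversalEdge {V γ : Type*} [DecidableEq V] {k : ℕ} (φ : Fin k × γ ↪ V)
    (z : Fin k → γ) (i : Fin k) (y : γ) : φ (i, y) ∈ transversalEdge φ z ↔ y = z i := by
  simp only [transversalEdge, Finset.mem_image, Finset.mem_univ, true_and,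
    EmbeddingLike.apply_eq_iff_eq, Prod.mk.injEq]
  constructor
  · rintro ⟨j, rfl, h⟩
    exact h.symm
  · rintro rfl
    exact ⟨i, rfl, rfl⟩

theorem transversalEdge_injective {V γ : Type*} [DecidableEq V] {k : ℕ} (φ : Fin k × γ ↪ V) :
    Function.Injective (transversalEdge φ) := by
  intro z w h
  funext i
  rw [← mem_transversalEdge φ w i, ← h, mem_transversalEdge]

theorem card_transversalEdge {V γ : Type*} [DecidableEq V] {k : ℕ} (φ : Fin k × γ ↪ V)
    (z : Fin k → γ) : (transversalEdge φ z).card = k := by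
  rw [transversalEdge, Finset.card_image_of_injective, Finset.card_univ, Fintype.card_fin]
  intro i j h
  exact congrArg Prod.fst (φ.injective h)

theorem partwiseLinked_of_hyperDiam_le {V γ : Type*} [DecidableEq V] {k : ℕ}
    (hk : 2 ≤ k) (φ : Fin k × γ ↪ V) (R : Finset (Fin k → γ))
    (hR : hyperDiam k (R.image (transversalEdge φ)) ≤ (3 : ℕ)) : PartwiseLinked R := by
  intro i x hx y hy hxy
  -- The part of a vertex; the default value off the range of `φ` is harmless, as all edges lie in
  -- that range.
  let c : V → Fin k := Function.extend φ Prod.fst (fun _ => ⟨0, by omega⟩)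
  have hc : ∀ w, c (φ w) = w.1 := fun w => φ.injective.extend_apply _ _ w
  have cov : ∀ z ∈ R, φ (i, z i) ∈ coveredVertices (R.image (transversalEdge φ)) := by
    intro z hz
    exact Finset.mem_biUnion.mpr ⟨_, Finset.mem_image_of_mem _ hz,
      (mem_transversalEdge φ z i _).mpr rfl⟩
  have hne : φ (i, x i) ≠ φ (i, y i) := fun h => hxy (congrArg Prod.snd (φ.injective h))
  obtain ⟨ℓ, hℓ, hj⟩ := (hyperDiam_le_iff k _ 3).mp hR _ (cov x hx) _ (cov y hy) hne
  obtain ⟨S, h1, h2⟩ := exists_common_link hk c _ (by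
    intro e he
    obtain ⟨z, -, rfl⟩ := Finset.mem_image.mp he
    intro u hu v hv huv
    obtain ⟨j, -, rfl⟩ := Finset.mem_image.mp hu
    obtain ⟨j', -, rfl⟩ := Finset.mem_image.mp hv
    rw [hc, hc] at huv
    simp only at huv
    rw [huv]) hℓ hne (by rw [hc, hc]) hj
  obtain ⟨z, hz, hzS⟩ := Finset.mem_image.mp h1
  obtain ⟨w, hw, hwS⟩ := Finset.mem_image.mp h2
  refine ⟨z, hz, w, hw, ?_, ?_, ?_⟩
  · exact ((mem_transversalEdge φ z i _).mp (hzS ▸ Finset.mem_insert_self _ _)).symm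
  · exact ((mem_transversalEdge φ w i _).mp (hwS ▸ Finset.mem_insert_self _ _)).symm
  · intro j hji
    have h3 := (mem_transversalEdge φ z j _).mpr rfl
    rw [hzS] at h3
    have h4 : φ (j, z j) ∈ S := by
      refine Finset.mem_of_mem_insert_of_ne h3 fun h => hji ?_
      exact congrArg Prod.fst (φ.injective h)
    have h5 := Finset.mem_insert_of_mem (b := φ (i, y i)) h4
    rw [← hwS] at h5
    exact (mem_transversalEdge φ w j _).mp h5

/-! ### Counting in the blown-up hypergraph. -/

theorem PartwiseLinked.image_comp {k : ℕ} {α β : Type*} [DecidableEq (Fin k → β)] (π : α → β)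
    {R : Finset (Fin k → α)} (hR : PartwiseLinked R) :
    PartwiseLinked (R.image (fun z i => π (z i))) := by
  intro i x hx y hy hxy
  obtain ⟨x, hxR, rfl⟩ := Finset.mem_image.mp hx
  obtain ⟨y, hyR, rfl⟩ := Finset.mem_image.mp hy
  obtain ⟨z, hz, w, hw, h1, h2, h3⟩ := hR i x hxR y hyR (fun h => hxy (congrArg π h))
  exact ⟨_, Finset.mem_image_of_mem _ hz, _, Finset.mem_image_of_mem _ hw, congrArg π h1,
    congrArg π h2, fun j hj => congrArg π (h3 j hj)⟩

theorem card_le_card_image_fst_mul {k : ℕ} {α β : Type*} [DecidableEq (Fin k → α)] [Fintype β]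
    (R : Finset (Fin k → α × β)) :
    R.card ≤ (R.image (fun z i => (z i).1)).card * Fintype.card β ^ k := by
  classical
  have : R.card ≤ (R.image (fun z i => (z i).1) ×ˢ (Finset.univ : Finset (Fin k → β))).card := by
    refine Finset.card_le_card_of_injOn (fun z => (fun i => (z i).1, fun i => (z i).2)) ?_ ?_
    · intro z hz
      exact Finset.mem_product.mpr ⟨Finset.mem_image_of_mem _ hz, Finset.mem_univ _⟩
    · intro z _ w _ h
      simp only [Prod.mk.injEq] at h
      funext i
      exact Prod.ext (congrFun h.1 i) (congrFun h.2 i)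
  simpa using this

/-- All first coordinates, all blow-up indices and all second coordinates but that of part 0 are
free; the equation then determines the remaining one. -/
theorem card_transversals_ge {k q N : ℕ} [NeZero q] (hk : 1 ≤ k)
    (Q : (Fin k → ZMod q) → ZMod q) :
    q ^ (2 * k - 1) * N ^ k ≤ (Finset.univ.filter (fun z : Fin k → (ZMod q × ZMod q) × Fin N =>
      ∑ i, (z i).1.2 = Q (fun i => (z i).1.1))).card := by
  obtain ⟨k, rfl⟩ := Nat.exists_eq_add_of_le' hk
  have h : (Finset.univ : Finset ((Fin (k + 1) → ZMod q) × (Fin k → ZMod q) ×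
      (Fin (k + 1) → Fin N))).card = q ^ (2 * (k + 1) - 1) * N ^ (k + 1) := by
    simp only [Finset.card_univ, Fintype.card_prod, Fintype.card_pi, Finset.prod_const,
      Fintype.card_fin, ZMod.card]
    rw [← mul_assoc, ← pow_add]
    congr 2
    omega
  rw [← h]
  refine Finset.card_le_card_of_injOn (fun w i =>
    ((w.1 i, (Fin.cons (Q w.1 - ∑ j, w.2.1 j) w.2.1 : Fin (k + 1) → ZMod q) i), w.2.2 i)) ?_ ?_
  · intro w _
    simp [Fin.sum_univ_succ]
  · intro w _ w' _ h
    have h' := fun i => congrFun h i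
    simp only [Prod.mk.injEq] at h'
    refine Prod.ext (funext fun i => (h' i).1.1) (Prod.ext (funext fun i => ?_)
      (funext fun i => (h' i).2))
    simpa using (h' i.succ).1.2

/-- There are `k`-uniform hypergraphs of density about `1 / q` in which sets of edges of diameter at
most `3` are as small as possible. -/
theorem exists_hypergraph_small_diam_three (k : ℕ) (hk : 2 ≤ k) :
    ∃ C : ℕ, 0 < C ∧ ∀ q N n : ℕ, q.Prime → k * q ^ 2 * N ≤ n →
      ∃ E : Finset (Finset (Fin n)), (E : Set (Finset (Fin n))).Sized k ∧
        q ^ (2 * k - 1) * N ^ k ≤ E.card ∧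
        ∀ F ⊆ E, hyperDiam k F ≤ (3 : ℕ) → F.card ≤ C * q ^ (k - 1) * N ^ k := by
  classical
  obtain ⟨C, hC, hex⟩ := exists_sparse_partwiseLinked k hk
  refine ⟨C, hC, fun q N n hq hn => ?_⟩
  obtain ⟨Q, hQ⟩ := hex q hq
  have : NeZero q := ⟨hq.ne_zero⟩
  obtain ⟨φ⟩ : Nonempty (Fin k × ((ZMod q × ZMod q) × Fin N) ↪ Fin n) := by
    refine Function.Embedding.nonempty_of_card_le ?_
    simp only [Fintype.card_prod, Fintype.card_fin, ZMod.card]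
    calc k * (q * q * N) = k * q ^ 2 * N := by ring
      _ ≤ n := hn
  let H := Finset.univ.filter (fun z : Fin k → (ZMod q × ZMod q) × Fin N =>
      ∑ i, (z i).1.2 = Q (fun i => (z i).1.1))
  refine ⟨H.image (transversalEdge φ), ?_, ?_, ?_⟩
  · intro e he
    obtain ⟨z, -, rfl⟩ := Finset.mem_image.mp (Finset.mem_coe.mp he)
    exact card_transversalEdge φ z
  · rw [Finset.card_image_of_injective _ (transversalEdge_injective φ)]
    exact card_transversals_ge (by omega) Q
  · intro F hF hdiam
    obtain ⟨R, hRH, rfl⟩ := Finset.subset_image_iff.mp hF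
    have hR := partwiseLinked_of_hyperDiam_le hk φ R hdiam
    have h1 := hQ _ (hR.image_comp Prod.fst) (by
      intro x hx
      obtain ⟨z, hz, rfl⟩ := Finset.mem_image.mp hx
      exact (Finset.mem_filter.mp (hRH hz)).2)
    have h2 := card_le_card_image_fst_mul R
    rw [Fintype.card_fin] at h2
    exact Finset.card_image_le.trans (h2.trans (Nat.mul_le_mul_right _ h1))

/-! ### Choice of the parameters. -/

theorem mainTheorem4 (k : ℕ) (hk : 2 ≤ k) :
    ∃ c C C' : ℝ, 0 < c ∧ 0 < C ∧ 0 < C' ∧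
      ∀ (n : ℕ) (ε : ℝ), 1 ≤ n → C' * (n : ℝ) ^ (-(1 / 2) : ℝ) ≤ ε → ε ≤ C →
        c * ε ^ (-(k : ℤ)) ≤ (diamPartitionNumber k n ε 3 : ℝ) := by
  obtain ⟨K, hK, hex⟩ := exists_hypergraph_small_diam_three k hk
  have hk0 : (0 : ℝ) < k := by positivity
  have hK0 : (0 : ℝ) < K := by exact_mod_cast hK
  -- `δ` bounds `q * ε` from above; the factor `(2 * k) ^ k` is the loss from `n ≤ 2 * k * q ^ 2 *
  -- N`, so that `E₀` takes at most half of the edges.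
  obtain ⟨δ, hδ, hδ1, hδk⟩ : ∃ δ : ℝ, 0 < δ ∧ δ ≤ 1 ∧ δ * (2 * k) ^ k = 1 / 2 := by
    have h1 : (1 : ℝ) ≤ (2 * k) ^ k := one_le_pow₀ (by
      have : (2 : ℝ) ≤ k := by exact_mod_cast hk
      linarith)
    refine ⟨1 / (2 * (2 * k) ^ k), by positivity, ?_, by field_simp⟩
    rw [div_le_one (by positivity)]
    linarith
  refine ⟨(δ / 2) ^ k / (2 * K), δ / 2, k, by positivity, by positivity, hk0, ?_⟩
  intro n ε hn hεn hεC
  have hn0 : (0 : ℝ) < n := by exact_mod_cast hn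
  have hε : 0 < ε := lt_of_lt_of_le (by positivity) hεn
  have hεsq : (k : ℝ) ^ 2 ≤ ε ^ 2 * n := by
    have h1 : ((n : ℝ) ^ (-(1 / 2) : ℝ)) ^ 2 = (n : ℝ)⁻¹ := by
      rw [← Real.rpow_natCast, ← Real.rpow_mul hn0.le, ← Real.rpow_neg_one]
      norm_num
    have h2 : ((k : ℝ) * (n : ℝ) ^ (-(1 / 2) : ℝ)) ^ 2 ≤ ε ^ 2 := by gcongr
    rw [mul_pow, h1, ← div_eq_mul_inv, div_le_iff₀ hn0] at h2
    exact h2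
  -- Bertrand's postulate above `⌊δ / 2 / ε⌋₊`, which is nonzero because `ε ≤ δ / 2`.
  obtain ⟨q, hq, hqlow, hqup⟩ : ∃ q : ℕ, q.Prime ∧ δ / 2 ≤ q * ε ∧ q * ε ≤ δ := by
    have h1 : 1 ≤ δ / 2 / ε := by rwa [le_div_iff₀ hε, one_mul]
    have h2 : ⌊δ / 2 / ε⌋₊ ≠ 0 := (Nat.floor_pos.mpr h1).ne'
    obtain ⟨q, hq, h3, h4⟩ := Nat.exists_prime_lt_and_le_two_mul _ h2
    have h5 : (⌊δ / 2 / ε⌋₊ : ℝ) ≤ δ / 2 / ε := Nat.floor_le (by positivity)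
    have h6 := Nat.lt_floor_add_one (δ / 2 / ε)
    have h7 : (⌊δ / 2 / ε⌋₊ : ℝ) + 1 ≤ q := by exact_mod_cast h3
    have h8 : (q : ℝ) ≤ 2 * ⌊δ / 2 / ε⌋₊ := by exact_mod_cast h4
    refine ⟨q, hq, ?_, ?_⟩
    · rw [← div_le_iff₀ hε]; linarith
    · rw [← le_div_iff₀ hε]
      calc (q : ℝ) ≤ 2 * (δ / 2 / ε) := by linarith
        _ = δ / ε := by ring
  have hq0 : (0 : ℝ) < q := by exact_mod_cast hq.pos
  -- The lower bound on `ε` enters here: it leaves room for at least one copy of each point.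
  have hkq : k * q ^ 2 ≤ n := by
    have h1 : (q * ε) ^ 2 ≤ 1 := pow_le_one₀ (by positivity) (hqup.trans hδ1)
    have h2 : (k : ℝ) * q ^ 2 * (ε ^ 2 * k) ≤ n * (ε ^ 2 * k) := by
      calc (k : ℝ) * q ^ 2 * (ε ^ 2 * k) = (k : ℝ) ^ 2 * (q * ε) ^ 2 := by ring
        _ ≤ (k : ℝ) ^ 2 * 1 := by gcongr
        _ ≤ ε ^ 2 * n := by linarith
        _ ≤ ε ^ 2 * n * k := le_mul_of_one_le_right (by positivity) (by
            exact_mod_cast (by omega : 1 ≤ k))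
        _ = n * (ε ^ 2 * k) := by ring
    have h3 := le_of_mul_le_mul_right h2 (by positivity)
    exact_mod_cast h3
  have hm : 0 < k * q ^ 2 := Nat.mul_pos (by omega) (pow_pos hq.pos 2)
  obtain ⟨N, hN⟩ : ∃ N, N = n / (k * q ^ 2) := ⟨_, rfl⟩
  have hN1 : 1 ≤ N := by rw [hN, Nat.one_le_div_iff hm]; exact hkq
  have hNn : k * q ^ 2 * N ≤ n := by rw [hN]; exact Nat.mul_div_le _ _
  have hnN : n ≤ 2 * k * q ^ 2 * N := by
    have h1 : n < k * q ^ 2 * (N + 1) := by rw [hN]; exact Nat.lt_mul_div_succ n hm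
    have h2 : k * q ^ 2 ≤ k * q ^ 2 * N := Nat.le_mul_of_pos_right _ hN1
    linarith
  obtain ⟨E, hEk, hEcard, hEF⟩ := hex q N n hq hNn
  set ℓ := diamPartitionNumber k n ε 3 with hℓ
  have hpart : HasDiamPartition k n ε 3 ℓ E :=
    Nat.sInf_mem (diamPartitionNumber_set_nonempty k n ε hε.le 3 (by norm_num)) E hEk
  obtain ⟨E₀, F, hE, -, -, hE₀, hF⟩ := hpart
  have hFcard : ∀ i, (F i).card ≤ K * q ^ (k - 1) * N ^ k := by
    intro i
    refine hEF _ ?_ (hF i)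
    rw [hE]
    exact (Finset.subset_biUnion_of_mem F (Finset.mem_univ i)).trans Finset.subset_union_right
  have hcount : E.card ≤ E₀.card + ℓ * (K * q ^ (k - 1) * N ^ k) := by
    rw [hE]
    refine (Finset.card_union_le _ _).trans (Nat.add_le_add_left ?_ _)
    refine Finset.card_biUnion_le.trans ?_
    simpa using Finset.sum_le_card_nsmul Finset.univ _ _ (fun i _ => hFcard i)
  have hcount' : (q : ℝ) ^ (2 * k - 1) * N ^ k ≤
      ε * (n : ℝ) ^ k + ℓ * (K * q ^ (k - 1) * N ^ k) := by
    have h1 : ((q ^ (2 * k - 1) * N ^ k : ℕ) : ℝ) ≤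
        ((E₀.card + ℓ * (K * q ^ (k - 1) * N ^ k) : ℕ) : ℝ) := by
      exact_mod_cast hEcard.trans hcount
    push_cast at h1
    linarith
  have hN0 : (0 : ℝ) < (N : ℝ) ^ k := by
    have : (0 : ℝ) < N := by exact_mod_cast hN1
    positivity
  have hpow : (q : ℝ) ^ (2 * k - 1) = q ^ k * q ^ (k - 1) := by
    rw [← pow_add]; congr 1; omega
  have hpow' : (q : ℝ) ^ (2 * k) = q * (q ^ k * q ^ (k - 1)) := by
    rw [← hpow, ← pow_succ']; congr 1; omega
  have hrest : ε * (n : ℝ) ^ k ≤ 1 / 2 * (q ^ k * q ^ (k - 1) * N ^ k) := by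
    have h1 : (n : ℝ) ≤ 2 * k * q ^ 2 * N := by exact_mod_cast hnN
    calc ε * (n : ℝ) ^ k ≤ ε * (2 * k * q ^ 2 * N) ^ k := by gcongr
      _ = (q * ε) * (2 * k) ^ k * (q ^ k * q ^ (k - 1) * N ^ k) := by
          rw [mul_pow, mul_pow, ← pow_mul, hpow']; ring
      _ ≤ δ * (2 * k) ^ k * (q ^ k * q ^ (k - 1) * N ^ k) := by gcongr
      _ = _ := by rw [hδk]
  rw [hpow] at hcount'
  have hmain : (q : ℝ) ^ k ≤ 2 * K * ℓ := by
    have h1 : (0 : ℝ) < q ^ (k - 1) * N ^ k := by positivity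
    refine le_of_mul_le_mul_right ?_ h1
    linarith
  have hfin : (δ / 2) ^ k ≤ 2 * K * ℓ * ε ^ k := by
    calc (δ / 2) ^ k ≤ (q * ε) ^ k := by gcongr
      _ = q ^ k * ε ^ k := mul_pow _ _ _
      _ ≤ _ := by gcongr
  rw [zpow_neg, zpow_natCast, ← div_eq_mul_inv, div_le_iff₀ (by positivity),
    div_le_iff₀ (by positivity)]
  linarith
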